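/- **Setting.** $\lambda\in\mathbb N$ is the security parameter; all lengths below are functions of $\lambda$. A *QPT* distinguisher is a family of quantum circuits of polynomial size (over a discrete universal gate set, not necessarily uniform), possibly with classical oracle queries. $\bot$ is a special output. A *generalized puncturable keyed circuit class in $\mathsf{P/poly}$* with input length $n$ and output length $m$ consists of key sets $\mathcal K_\lambda$, polynomial-size circuits $C_k:\{0,1\}^{n(\lambda)}\to\{0,1\}^{m(\lambda)}$ for $k\in\mathcal K_\lambda$, and a deterministic puncturing algorithm which, on $k$, circuits $\mu_{\mathcal B},\mu_{\mathcal C}:\{0,1\}^{n}\to\{0,1\}^{m}$ and points $x^{\mathcal B},x^{\mathcal C}\in\{0,1\}^n$, outputs a circuit, of size polynomial in $\lambda$ and the sizes of $\mu_{\mathcal B},\mu_{\mathcal C}$, that maps $x^{\mathcal B}$ to $\mu_{\mathcal B}(x^{\mathcal B})$, maps $x^{\mathcal C}$ to $\mu_{\mathcal C}(x^{\mathcal C})$ if $x^{\mathcal C}\ne x^{\mathcal B}$, and agrees with $C_k$ elsewhere. A pair $(\mathsf{Obf},\mathsf{Eval})$, where $\mathsf{Obf}(1^\lambda,C)$ outputs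 a quantum state $\rho_C$ and $\mathsf{Eval}(\rho_C,x)$ outputs a string or $\bot$, is *$\delta$-correct* for the class if for all $\lambda$, all $k\in\mathcal K_\lambda$ and all $x\in\{0,1\}^{n(\lambda)}$, $\Pr[\mathsf{Eval}(\rho,x)=C_k(x)\;:\;\rho\leftarrow\mathsf{Obf}(1^\lambda,C_k)]\ge\delta(\lambda)$. **Parameters and primitives.** Let $\ell_0,\ell_1,q,\kappa,r,m$ be lengths with $\ell_1(\lambda)\ge\lambda$ for all $\lambda$, put $\ell_2=\ell_0+q$ and $n=\ell_0+\ell_1+\ell_2$, and write $x\in\{0,1\}^n$ as $x_0\|x_1\|x_2$ with $|x_i|=\ell_i$. Let $F_1:\{0,1\}^n\to\{0,1\}^r$, $F_2:\{0,1\}^{\ell_2}\to\{0,1\}^{\ell_1}$, $F_3:\{0,1\}^{\ell_1}\to\{0,1\}^{\ell_2}$ be post-quantum pseudorandom function families (key generation and evaluation by polynomial-size circuits; no QPT distinguisher with classical oracle queries tells a random member from a random function with non-negligible advantage), let $\mathsf{PRG}:\{0,1\}^r\to\{0,1\}^{2r}$ be an injective post-quantum pseudorandom generator, let $\mathsf{iO}$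 be an obfuscator for classical circuits with perfect correctness (each possible output on input $C$ computes the same function as $C$; for instance any post-quantum indistinguishability obfuscator), and fix a way to read strings of length $q$ as circuits from $\{0,1\}^{\ell_0\kappa}$ to $\{0,1\}^r\cup\{\bot\}$. Wherever a circuit is described by the function that it computes, any circuit computing this function may be used. For a subspace $A\subseteq\mathbb F_2^\kappa$ and $s,s'\in\mathbb F_2^\kappa$ let $|A_{s,s'}\rangle=|A|^{-1/2}\sum_{a\in A}(-1)^{\langle s',a\rangle}|a+s\rangle$. **Construction.** $\mathsf{CLLZ.CopyProtect}(1^\lambda,K_1)$: sample keys $K_2,K_3$ of $F_2,F_3$ and, for $i\in[\ell_0]$, independent uniform subspaces $A_i\subseteq\mathbb F_2^\kappa$ of dimension $\lfloor\kappa/2\rfloor$ and $s_i,s_i'\in\mathbb F_2^\kappa$; let $R_i^0\leftarrow\mathsf{iO}(A_i+s_i)$ and $R_i^1\leftarrow\mathsf{iO}(A_i^\perp+s_i')$ be obfuscated membership tests; output $P'\leftarrow\mathsf{iO}(P)$ and $\{|(A_i)_{s_i,s_i'}\rangle\}_i$, where $P$ on input $x$ and $v=(v_1,\dots,v_{\ell_0})$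 does the following. If $F_3(K_3,x_1)\oplus x_2=x_0\|Q$ for some $Q\in\{0,1\}^q$ and $x_1=F_2(K_2,x_0\|Q)$, it outputs $Q(v)$, with $Q$ read as a circuit; otherwise it outputs $F_1(K_1,x)$ if $R_i^{x_{0,i}}(v_i)=1$ for all $i$, and $\bot$ if not. $\mathsf{Obf}(1^\lambda,W)$: sample a key $k$ of $F_1$; let $(P',\{|(A_i)_{s_i,s_i'}\rangle\}_i)\leftarrow\mathsf{CLLZ.CopyProtect}(1^\lambda,k)$; let $C=\mathsf{PRG}\circ P'$ (with $\bot\mapsto\bot$) and $\tilde C\leftarrow\mathsf{iO}(C)$; let $\tilde D\leftarrow\mathsf{iO}(D)$, where $D$ on input $x,v,y$ computes $y'=C(x,v)$ and outputs $\bot$ if $y'\neq y$ or $y'=\bot$, and $W(x)$ otherwise; output $\rho=(\{|(A_i)_{s_i,s_i'}\rangle\}_i,\tilde C,\tilde D)$. $\mathsf{Eval}(\rho,x)$: for each $i$ with $x_{0,i}=1$ apply $H^{\otimes\kappa}$ to the $i$-th coset state; run $\tilde C$ in superposition on $x$ and the resulting register $V$, and measure the output $y$; run $\tilde D$ in superposition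 on $x$, the register $V$ and $y$, measure the output $z$, and output $z$. **Lemma.** There is a negligible function $\mathsf{negl}$ such that for every generalized puncturable keyed circuit class in $\mathsf{P/poly}$ with input length $n$ and output length $m$, the scheme $(\mathsf{Obf},\mathsf{Eval})$ is $(1-\mathsf{negl})$-correct. -/

import Mathlib

open scoped BigOperators Matrix

noncomputable section

namespace UPO

/-! ## Bit strings, polynomial bounds, negligible functions -/

/-- Bit strings of length `n`. -/
abbrev Bits (n : ℕ) : Type := Fin n → Bool

/-- Bitwise exclusive or. -/
def bxor {n : ℕ} (x y : Bits n) : Bits n := fun i => xor (x i) (y i)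

/-- `f` is bounded by a polynomial in the security parameter. -/
def PolyBounded (f : ℕ → ℕ) : Prop :=
  ∃ p : Polynomial ℕ, ∀ lam, f lam ≤ p.eval lam

/-- `f` is negligible: it decays faster than every inverse polynomial. -/
def Negligible (f : ℕ → ℝ) : Prop :=
  Asymptotics.SuperpolynomialDecay Filter.atTop (fun lam : ℕ => (lam : ℝ)) f

/-! ## Classical circuits -/

/-- Boolean circuits with `n` input bits and `m` output bits, as straight-line programs over NAND.
Wires `0, …, n - 1` carry the input and wire `n + j` carries the value of the `j`-th gate; a
reference to a wire that does not (yet) exist reads the constant `false`. -/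
structure Circuit (n m : ℕ) where
  gates : List (ℕ × ℕ)
  out : Fin m → ℕ

namespace Circuit

/-- The values of all wires on input `x`. -/
def wires {n m : ℕ} (C : Circuit n m) (x : Bits n) : List Bool :=
  C.gates.foldl (fun w g => w ++ [!(w.getD g.1 false && w.getD g.2 false)]) (List.ofFn x)

/-- The function `{0,1}ⁿ → {0,1}ᵐ` computed by the circuit. -/
def eval {n m : ℕ} (C : Circuit n m) (x : Bits n) : Bits m :=
  fun i => (C.wires x).getD (C.out i) false

/-- Number of gates plus number of input and output bits. -/
def size {n m : ℕ} (C : Circuit n m) : ℕ := n + m + C.gates.length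

end Circuit

/-- A value in `{0,1}ᵐ ∪ {⊥}` written on `m + 1` bits: a flag, followed by the value. -/
def encodeBot {m : ℕ} : Option (Bits m) → Bits (m + 1)
  | none => fun _ => false
  | some y => Fin.cons true y

/-- Reading `m + 1` bits as a value in `{0,1}ᵐ ∪ {⊥}`. -/
def decodeBot {m : ℕ} (z : Bits (m + 1)) : Option (Bits m) :=
  if z 0 = true then some (Fin.tail z) else none

/-! ## Keyed circuit classes -/

/-- A generalized puncturable keyed circuit class in P/poly, with input length `n` and output
length `m`. -/
structure GenPuncturableClass (n m : ℕ → ℕ) where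
  Key : ℕ → Type
  /-- the keyed circuit `C_k` -/
  circ : ∀ lam, Key lam → Circuit (n lam) (m lam)
  /-- all circuits of the class are of polynomial size -/
  poly_size : ∃ p : Polynomial ℕ, ∀ lam k, (circ lam k).size ≤ p.eval lam
  /-- the (deterministic) puncturing algorithm -/
  genPuncture : ∀ lam, Key lam → (μB μC : Circuit (n lam) (m lam)) → (xB xC : Bits (n lam)) →
    Circuit (n lam) (m lam)
  /-- the output of the puncturing algorithm is of polynomial size -/
  genPuncture_poly_size : ∃ p : Polynomial ℕ, ∀ lam k μB μC xB xC,
    (genPuncture lam k μB μC xB xC).size ≤ p.eval (lam + μB.size + μC.size)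
  /-- on the two punctured points, the values are those of `μB` and `μC`, with precedence to `μB`
  if the points coincide; elsewhere the function does not change -/
  genPuncture_eval : ∀ lam k μB μC xB xC x,
    (genPuncture lam k μB μC xB xC).eval x =
      if x = xB then μB.eval xB else if x = xC then μC.eval xC else (circ lam k).eval x

/-! ## Quantum polynomial-time distinguishers -/

/-- Gates of a discrete universal gate set, on `w` qubits. -/
inductive QGate (w : ℕ) : Type
  | x (i : Fin w)
  | h (i : Fin w)
  | t (i : Fin w)
  | cnot (c i : Fin w) (hc : c ≠ i)
  | toffoli (c₁ c₂ i : Fin w) (h₁ : c₁ ≠ i) (h₂ : c₂ ≠ i)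

/-- The action of a gate on a vector of amplitudes. -/
def QGate.apply {w : ℕ} : QGate w → (Bits w → ℂ) → (Bits w → ℂ)
  | .x i, ψ => fun u => ψ (Function.update u i (!(u i)))
  | .h i, ψ => fun u => ((Real.sqrt 2 : ℝ) : ℂ)⁻¹ *
      (ψ (Function.update u i false) + (if u i then -1 else 1) * ψ (Function.update u i true))
  | .t i, ψ => fun u => (if u i then Complex.exp (Complex.I * Real.pi / 4) else 1) * ψ u
  | .cnot c i _, ψ => fun u => ψ (Function.update u i (xor (u i) (u c)))
  | .toffoli c₁ c₂ i _ _, ψ => fun u => ψ (Function.update u i (xor (u i) (u c₁ && u c₂)))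

/-- Instructions of an oracle algorithm on `w` qubits with an oracle `{0,1}ᵃ → {0,1}ᵇ`. -/
inductive QInstr (a b w : ℕ) : Type
  | gate (g : QGate w)
  /-- a classical query: measure the qubits `inp` and add the answer of the oracle, bit by bit, to
  the qubits `out` -/
  | query (inp : Fin a → Fin w) (out : Fin b ↪ Fin w)

/-- The (unnormalised) state after a query has been made, for the outcome `q` of the measurement
of the query register. -/
def queryBranch {a b w : ℕ} (f : Bits a → Bits b) (inp : Fin a → Fin w) (out : Fin b ↪ Fin w)
    (q : Bits a) (ψ : Bits w → ℂ) : Bits w → ℂ :=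
  let proj : Bits w → ℂ := fun u => if (fun j => u (inp j)) = q then ψ u else 0
  fun u => proj (fun i => xor (u i) (decide (∃ j, out j = i ∧ f q j = true)))

/-- The probability that measuring the qubit `o` at the end gives `1`, when the instructions are
run with the oracle `f` on the state `ψ`. -/
def acceptProb {a b w : ℕ} (f : Bits a → Bits b) (o : Fin w) :
    List (QInstr a b w) → (Bits w → ℂ) → ℝ
  | [], ψ => ∑ u : Bits w, if u o then Complex.normSq (ψ u) else 0
  | .gate g :: l, ψ => acceptProb f o l (g.apply ψ)
  | .query inp out :: l, ψ => ∑ q : Bits a, acceptProb f o l (queryBranch f inp out q ψ)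

/-- A quantum oracle circuit with a one-bit output. -/
structure OracleCircuit (a b : ℕ) where
  width : ℕ
  output : Fin width
  instrs : List (QInstr a b width)

/-- Number of qubits plus number of gates and queries. -/
def OracleCircuit.size {a b : ℕ} (A : OracleCircuit a b) : ℕ := A.width + A.instrs.length

/-- The probability that `A` outputs `1` with oracle `f`, started on `|0…0⟩`. -/
def OracleCircuit.prob {a b : ℕ} (A : OracleCircuit a b) (f : Bits a → Bits b) : ℝ :=
  acceptProb f A.output A.instrs (fun u => if u = fun _ => false then 1 else 0)

/-- A quantum polynomial-time (QPT) algorithm: a family of circuits of polynomial size. -/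
structure QPTDistinguisher (a b : ℕ → ℕ) where
  circ : ∀ lam, OracleCircuit (a lam) (b lam)
  poly_size : PolyBounded fun lam => (circ lam).size

/-! ## Pseudorandom functions and generators -/

/-- A post-quantum pseudorandom function family `{0,1}ᵃ → {0,1}ᵇ`. -/
structure PRF (a b : ℕ → ℕ) where
  coinLen : ℕ → ℕ
  keyLen : ℕ → ℕ
  /-- key generation, as a function of its random coins -/
  keyGenCirc : ∀ lam, Circuit (coinLen lam) (keyLen lam)
  /-- evaluation, on the key followed by the input -/
  evalCirc : ∀ lam, Circuit (keyLen lam + a lam) (b lam)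
  keyGen_poly : PolyBounded fun lam => (keyGenCirc lam).size
  eval_poly : PolyBounded fun lam => (evalCirc lam).size
  /-- no QPT algorithm can tell the function with a random key from a random function -/
  secure : ∀ A : QPTDistinguisher a b, Negligible fun lam =>
    |(∑ c : Bits (coinLen lam), (A.circ lam).prob
          (fun x => (evalCirc lam).eval (Fin.append ((keyGenCirc lam).eval c) x)))
        / Fintype.card (Bits (coinLen lam))
      - (∑ f : Bits (a lam) → Bits (b lam), (A.circ lam).prob f)
        / Fintype.card (Bits (a lam) → Bits (b lam))|

namespace PRF

variable {a b : ℕ → ℕ}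

/-- `KeyGen(1^λ)`. -/
def keyGen (F : PRF a b) (lam : ℕ) : PMF (Bits (F.keyLen lam)) :=
  (PMF.uniformOfFintype (Bits (F.coinLen lam))).map (F.keyGenCirc lam).eval

/-- `F(k, x)`. -/
def eval (F : PRF a b) (lam : ℕ) (k : Bits (F.keyLen lam)) (x : Bits (a lam)) : Bits (b lam) :=
  (F.evalCirc lam).eval (Fin.append k x)

end PRF

/-- A post-quantum length-doubling injective pseudorandom generator with seed length `r`. -/
structure InjectivePRG (r : ℕ → ℕ) where
  circ : ∀ lam, Circuit (r lam) (2 * r lam)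
  poly_size : PolyBounded fun lam => (circ lam).size
  injective : ∀ lam, Function.Injective (circ lam).eval
  /-- no QPT algorithm can tell the image of a random seed from a random string; the string is
  given through an oracle without input -/
  secure : ∀ A : QPTDistinguisher (fun _ => 0) (fun lam => 2 * r lam), Negligible fun lam =>
    |(∑ s : Bits (r lam), (A.circ lam).prob (fun _ => (circ lam).eval s))
        / Fintype.card (Bits (r lam))
      - (∑ y : Bits (2 * r lam), (A.circ lam).prob (fun _ => y))
        / Fintype.card (Bits (2 * r lam))|

/-- A circuit compiler: a randomised map from circuits to circuits with the same functionality.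
Every indistinguishability obfuscator (with perfect correctness) is one. -/
structure CircuitCompiler where
  obf : ∀ (_lam : ℕ) {n m : ℕ}, Circuit n m → PMF (Circuit n m)
  correct : ∀ (lam : ℕ) {n m : ℕ} (C C' : Circuit n m), C' ∈ (obf lam C).support →
    ∀ x, C'.eval x = C.eval x

/-! ## Quantum states and instruments -/

/-- Unit vectors of the register with computational basis `ι`. -/
def PureState (ι : Type) [Fintype ι] : Type :=
  {ψ : ι → ℂ // ∑ i, Complex.normSq (ψ i) = 1}

/-- A quantum operation with a classical output in `O`, given by its Kraus operators; in branch `j`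
the output is `out j` and the state that remains is proportional to `kraus j *ᵥ ψ`. -/
structure Instrument (ι O : Type) [Fintype ι] [DecidableEq ι] where
  Branch : Type
  Post : Type
  [fintypeBranch : Fintype Branch]
  [fintypePost : Fintype Post]
  kraus : Branch → Matrix Post ι ℂ
  out : Branch → O
  complete : ∑ j, (kraus j)ᴴ * kraus j = 1

attribute [instance] Instrument.fintypeBranch Instrument.fintypePost

theorem sum_normSq_mulVec {ι κ : Type} [Fintype ι] [Fintype κ] (M : Matrix κ ι ℂ) (ψ : ι → ℂ) :
    ((∑ p, Complex.normSq ((M *ᵥ ψ) p) : ℝ) : ℂ) = star ψ ⬝ᵥ ((Mᴴ * M) *ᵥ ψ) := by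
  rw [← Matrix.mulVec_mulVec, Matrix.dotProduct_mulVec, ← Matrix.star_mulVec]
  simp [dotProduct, Complex.normSq_eq_conj_mul_self]

theorem Instrument.sum_prob {ι O : Type} [Fintype ι] [DecidableEq ι] (E : Instrument ι O)
    (ψ : PureState ι) :
    ∑ j, ∑ p, Complex.normSq ((E.kraus j *ᵥ ψ.1) p) = 1 := by
  have h : ((∑ j, ∑ p, Complex.normSq ((E.kraus j *ᵥ ψ.1) p) : ℝ) : ℂ) = 1 := by
    rw [Complex.ofReal_sum]
    simp_rw [sum_normSq_mulVec]
    rw [← dotProduct_sum, ← Matrix.sum_mulVec, E.complete, Matrix.one_mulVec]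
    have h1 := congrArg (fun t : ℝ => (t : ℂ)) ψ.2
    simpa [dotProduct, Complex.normSq_eq_conj_mul_self] using h1
  exact_mod_cast h

/-- The law of the branch (Born rule). -/
def Instrument.branchLaw {ι O : Type} [Fintype ι] [DecidableEq ι] (E : Instrument ι O)
    (ψ : PureState ι) : PMF E.Branch :=
  PMF.ofFintype (fun j => ENNReal.ofReal (∑ p, Complex.normSq ((E.kraus j *ᵥ ψ.1) p))) (by
    rw [← ENNReal.ofReal_sum_of_nonneg
      (fun j _ => Finset.sum_nonneg fun p _ => Complex.normSq_nonneg _), E.sum_prob ψ,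
      ENNReal.ofReal_one])

/-- The law of the classical output. -/
def Instrument.outputLaw {ι O : Type} [Fintype ι] [DecidableEq ι] (E : Instrument ι O)
    (ψ : PureState ι) : PMF O :=
  (E.branchLaw ψ).map E.out

/-! ## Unclonable puncturable obfuscation: syntax and correctness -/

/-- The two algorithms of an obfuscation scheme with quantum obfuscated programs. The state `ρ_C`
consists of a classical part and of a pure state that depends on the randomness of `Obf`. -/
structure Scheme (n m : ℕ → ℕ) where
  Classical : ℕ → Type
  Reg : ℕ → Type
  [fintypeReg : ∀ lam, Fintype (Reg lam)]
  [decEqReg : ∀ lam, DecidableEq (Reg lam)]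
  obf : ∀ lam, Circuit (n lam) (m lam) → PMF (Classical lam × PureState (Reg lam))
  eval : ∀ lam, Classical lam → Bits (n lam) → Instrument (Reg lam) (Option (Bits (m lam)))

attribute [instance] Scheme.fintypeReg Scheme.decEqReg

/-- The law of the output of `Eval(ρ_C, x)` for `ρ_C ← Obf(1^λ, C)`. -/
def Scheme.outputLaw {n m : ℕ → ℕ} (S : Scheme n m) (lam : ℕ) (C : Circuit (n lam) (m lam))
    (x : Bits (n lam)) : PMF (Option (Bits (m lam))) :=
  (S.obf lam C).bind fun ρ => (S.eval lam ρ.1 x).outputLaw ρ.2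

/-- `δ`-correctness for a keyed circuit class. -/
def Scheme.IsCorrect {n m : ℕ → ℕ} (S : Scheme n m) (𝒞 : GenPuncturableClass n m) (δ : ℕ → ℝ) :
    Prop :=
  ∀ (lam : ℕ) (k : 𝒞.Key lam) (x : Bits (n lam)),
    δ lam ≤ (S.outputLaw lam (𝒞.circ lam k) x (some ((𝒞.circ lam k).eval x))).toReal

/-! ## Coset states and Hadamard transforms -/

/-- `𝔽₂^κ`. -/
abbrev Vec (κ : ℕ) : Type := Fin κ → ZMod 2

/-- A vector of `𝔽₂^κ` as a bit string. -/
def Vec.toBits {κ : ℕ} (v : Vec κ) : Bits κ := fun j => decide (v j = 1)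

/-- `A^⊥`, with respect to the standard bilinear form. -/
def perp {κ : ℕ} (A : Submodule (ZMod 2) (Vec κ)) : Submodule (ZMod 2) (Vec κ) where
  carrier := {w | ∀ a ∈ A, a ⬝ᵥ w = 0}
  add_mem' := fun {u v} hu hv a ha => by rw [dotProduct_add, hu a ha, hv a ha, add_zero]
  zero_mem' := fun a _ => dotProduct_zero a
  smul_mem' := fun c u hu a ha => by rw [dotProduct_smul, hu a ha, smul_zero]

/-- The description `(A, s, s')` of a coset state, with `A` of dimension `κ/2`. -/
abbrev CosetKey (κ : ℕ) : Type :=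
  {A : Submodule (ZMod 2) (Vec κ) // Module.finrank (ZMod 2) A = κ / 2} × Vec κ × Vec κ

instance (κ : ℕ) : Finite (Submodule (ZMod 2) (Vec κ)) :=
  Finite.of_injective (fun A => (A : Set (Vec κ))) SetLike.coe_injective

instance (κ : ℕ) :
    Fintype {A : Submodule (ZMod 2) (Vec κ) // Module.finrank (ZMod 2) A = κ / 2} :=
  Fintype.ofFinite _

instance (κ : ℕ) :
    Nonempty {A : Submodule (ZMod 2) (Vec κ) // Module.finrank (ZMod 2) A = κ / 2} := by
  have hli : LinearIndependent (ZMod 2)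
      ((Pi.basisFun (ZMod 2) (Fin κ)) ∘ (Fin.castLE (Nat.div_le_self κ 2))) :=
    (Pi.basisFun (ZMod 2) (Fin κ)).linearIndependent.comp _ (Fin.castLE_injective _)
  refine ⟨⟨Submodule.span (ZMod 2) (Set.range
    ((Pi.basisFun (ZMod 2) (Fin κ)) ∘ (Fin.castLE (Nat.div_le_self κ 2)))), ?_⟩⟩
  rw [finrank_span_eq_card hli, Fintype.card_fin]

open Classical in
/-- The amplitudes of the coset state
`|A_{s,s'}⟩ = |A|^{-1/2} ∑_{a ∈ A} (-1)^{⟨s', a⟩} |a + s⟩`. -/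
def cosetAmp {κ : ℕ} (K : CosetKey κ) (v : Vec κ) : ℂ :=
  if v - K.2.1 ∈ K.1.1 then
    ((Real.sqrt (Nat.card K.1.1) : ℝ) : ℂ)⁻¹ * (if K.2.2 ⬝ᵥ (v - K.2.1) = 0 then 1 else -1)
  else 0

theorem cosetAmp_norm {κ : ℕ} (K : CosetKey κ) : ∑ v, Complex.normSq (cosetAmp K v) = 1 := by
  classical
  have hpos : (0 : ℝ) < Nat.card K.1.1 := by exact_mod_cast Nat.card_pos
  have h1 : ∀ v, Complex.normSq (cosetAmp K v) =
      if v - K.2.1 ∈ K.1.1 then ((Nat.card K.1.1 : ℝ))⁻¹ else 0 := by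
    intro v
    have h2 : Complex.normSq
        (if K.2.2 ⬝ᵥ (v - K.2.1) = 0 then (1 : ℂ) else -1) = 1 := by split_ifs <;> simp
    by_cases h : v - K.2.1 ∈ K.1.1
    · rw [cosetAmp, if_pos h, if_pos h, Complex.normSq_mul, h2, map_inv₀, Complex.normSq_ofReal,
        Real.mul_self_sqrt hpos.le, mul_one]
    · rw [cosetAmp, if_neg h, if_neg h, map_zero]
  simp_rw [h1]
  rw [Fintype.sum_equiv (Equiv.subRight K.2.1)
    (fun v => if v - K.2.1 ∈ K.1.1 then ((Nat.card K.1.1 : ℝ))⁻¹ else 0)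
    (fun v => if v ∈ K.1.1 then ((Nat.card K.1.1 : ℝ))⁻¹ else 0) (fun v => rfl)]
  rw [← Finset.sum_filter, Finset.sum_const, nsmul_eq_mul]
  have : (Finset.univ.filter (fun v => v ∈ K.1.1)).card = Nat.card K.1.1 := by
    rw [Nat.card_eq_fintype_card, Fintype.card_subtype]
  rw [this, mul_inv_cancel₀ hpos.ne']

/-- The product state `⊗ᵢ |A_{i, sᵢ, s'ᵢ}⟩`. -/
def cosetState {ell κ : ℕ} (K : Fin ell → CosetKey κ) : PureState (Fin ell → Vec κ) :=
  ⟨fun v => ∏ i, cosetAmp (K i) (v i), by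
    simp_rw [map_prod]
    rw [← Fintype.prod_sum (fun i a => Complex.normSq (cosetAmp (K i) a))]
    exact Finset.prod_eq_one fun i _ => cosetAmp_norm (K i)⟩

/-- Tensor product of operators. -/
def tensorMat {ι α : Type} [Fintype ι] (M : ι → Matrix α α ℂ) : Matrix (ι → α) (ι → α) ℂ :=
  Matrix.of fun u v => ∏ i, M i (u i) (v i)

theorem tensorMat_isometry {ι α : Type} [Fintype ι] [DecidableEq ι] [Fintype α] [DecidableEq α]
    (M : ι → Matrix α α ℂ) (hM : ∀ i, (M i)ᴴ * M i = 1) :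
    (tensorMat M)ᴴ * tensorMat M = 1 := by
  ext u v
  have h : ∀ i, ∑ a, star (M i a (u i)) * M i a (v i) = if u i = v i then 1 else 0 := by
    intro i
    have := congrFun (congrFun (hM i) (u i)) (v i)
    simpa [Matrix.mul_apply, Matrix.one_apply] using this
  simp only [Matrix.mul_apply, Matrix.conjTranspose_apply, tensorMat, Matrix.of_apply, star_prod,
    ← Finset.prod_mul_distrib]
  rw [← Fintype.prod_sum (fun i a => star (M i a (u i)) * M i a (v i))]
  simp_rw [h, Matrix.one_apply]
  by_cases huv : u = v
  · simp [huv]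
  · rw [if_neg huv]
    obtain ⟨i, hi⟩ := Function.ne_iff.mp huv
    exact Finset.prod_eq_zero (Finset.mem_univ i) (if_neg hi)

/-- The Hadamard gate. -/
def hadamard : Matrix (ZMod 2) (ZMod 2) ℂ :=
  Matrix.of fun u v => ((Real.sqrt 2 : ℝ) : ℂ)⁻¹ * (if u * v = 0 then 1 else -1)

theorem hadamard_isometry : hadamardᴴ * hadamard = 1 := by
  have h2 : ((Real.sqrt 2 : ℝ) : ℂ)⁻¹ * ((Real.sqrt 2 : ℝ) : ℂ)⁻¹ = 1 / 2 := by
    rw [← mul_inv, ← Complex.ofReal_mul, Real.mul_self_sqrt (by norm_num)]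
    norm_num
  have hs : ∀ f : ZMod 2 → ℂ, ∑ j, f j = f 0 + f 1 := fun f => Fin.sum_univ_two f
  have h10 : (1 : ZMod 2) ≠ 0 := by decide
  have key : ∀ u v : ZMod 2, (u = 0 ∨ u = 1) ∧ (v = 0 ∨ v = 1) := by decide
  ext u v
  rw [Matrix.mul_apply, hs]
  obtain ⟨rfl | rfl, rfl | rfl⟩ := key u v <;>
    simp [hadamard, h2] <;> norm_num

/-- `H^{⊗κ}` on the `i`-th block for every `i` with `rᵢ = 1`, the identity on the other blocks. -/
def hadamardBlocks {ell : ℕ} (κ : ℕ) (r : Bits ell) :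
    Matrix (Fin ell → Vec κ) (Fin ell → Vec κ) ℂ :=
  tensorMat fun i => if r i = true then tensorMat (fun _ : Fin κ => hadamard) else 1

theorem hadamardBlocks_isometry {ell : ℕ} (κ : ℕ) (r : Bits ell) :
    (hadamardBlocks κ r)ᴴ * hadamardBlocks κ r = 1 := by
  refine tensorMat_isometry _ fun i => ?_
  split_ifs
  · exact tensorMat_isometry _ fun _ => hadamard_isometry
  · simp

/-! ## Running a classical circuit in superposition and measuring its output -/

/-- Adjoin an output register in state `|0…0⟩`. -/
def adjoinZero (V : Type) [DecidableEq V] (b : ℕ) : Matrix (V × Bits b) V ℂ :=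
  Matrix.of fun p v => if p = (v, fun _ => false) then 1 else 0

/-- The unitary `|v⟩|y⟩ ↦ |v⟩|y ⊕ f(v)⟩`. -/
def xorUnitary {V : Type} [DecidableEq V] {b : ℕ} (f : V → Bits b) :
    Matrix (V × Bits b) (V × Bits b) ℂ :=
  Matrix.of fun p p' => if p = (p'.1, bxor p'.2 (f p'.1)) then 1 else 0

/-- Outcome `y` of the measurement of the output register, which is discarded afterwards:
`I ⊗ ⟨y|`. -/
def measureOut (V : Type) [DecidableEq V] {b : ℕ} (y : Bits b) : Matrix V (V × Bits b) ℂ :=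
  Matrix.of fun v p => if p = (v, y) then 1 else 0

/-- Run `f` in superposition on the register with basis `V`, measure the output register, and get
outcome `y`. -/
def runMeasure {V : Type} [Fintype V] [DecidableEq V] {b : ℕ} (f : V → Bits b) (y : Bits b) :
    Matrix V V ℂ :=
  measureOut V y * xorUnitary f * adjoinZero V b

theorem runMeasure_eq {V : Type} [Fintype V] [DecidableEq V] {b : ℕ} (f : V → Bits b)
    (y : Bits b) : runMeasure f y = Matrix.diagonal fun v => if f v = y then 1 else 0 := by
  have h0 : ∀ z : Bits b, bxor (fun _ => false) z = z := fun z => by funext i; simp [bxor]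
  ext u v
  simp only [runMeasure, measureOut, xorUnitary, adjoinZero, Matrix.mul_apply, Matrix.of_apply,
    Matrix.diagonal_apply, mul_ite, mul_one, mul_zero,
    Finset.sum_ite_eq', Finset.mem_univ, if_true, h0, Prod.mk.injEq]
  by_cases huv : u = v
  · subst huv
    simp [eq_comm]
  · simp [huv, Ne.symm huv]

theorem runMeasure_complete {V : Type} [Fintype V] [DecidableEq V] {b : ℕ} (f : V → Bits b) :
    ∑ y, (runMeasure f y)ᴴ * runMeasure f y = 1 := by
  simp_rw [runMeasure_eq, Matrix.diagonal_conjTranspose, Matrix.diagonal_mul_diagonal]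
  ext u v
  rw [Matrix.sum_apply]
  by_cases huv : u = v
  · subst huv
    simp [apply_ite]
  · simp [huv]

/-! ## The construction -/

/-- The length parameters. The coset states live on `κ` qubits each, and there are `ℓ₀` of them;
the inputs `x = x₀ ‖ x₁ ‖ x₂` have `|x₀| = ℓ₀`, `|x₁| = ℓ₁` and `|x₂| = ℓ₀ + q`, where `q` is the
length of the description of a circuit `Q`; `r` is the output length of the primary pseudorandom
function and the seed length of the generator. -/
structure Params where
  ell0 : ℕ → ℕ
  ell1 : ℕ → ℕ
  q : ℕ → ℕ
  κ : ℕ → ℕ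
  r : ℕ → ℕ

namespace Params

variable (P : Params)

def ell2 (lam : ℕ) : ℕ := P.ell0 lam + P.q lam

/-- Input length. -/
def n (lam : ℕ) : ℕ := P.ell0 lam + P.ell1 lam + P.ell2 lam

/-- Number of bits of `v = (v₁, …, v_{ℓ₀})`. -/
def vLen (lam : ℕ) : ℕ := P.ell0 lam * P.κ lam

variable {P} {lam : ℕ}

def x0 (x : Bits (P.n lam)) : Bits (P.ell0 lam) :=
  fun i => x (Fin.castAdd (P.ell2 lam) (Fin.castAdd (P.ell1 lam) i))

def x1 (x : Bits (P.n lam)) : Bits (P.ell1 lam) :=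
  fun i => x (Fin.castAdd (P.ell2 lam) (Fin.natAdd (P.ell0 lam) i))

def x2 (x : Bits (P.n lam)) : Bits (P.ell2 lam) :=
  fun i => x (Fin.natAdd (P.ell0 lam + P.ell1 lam) i)

/-- The basis states of the register `V`. -/
abbrev VReg (P : Params) (lam : ℕ) : Type := Fin (P.ell0 lam) → Vec (P.κ lam)

/-- `v₁ ‖ … ‖ v_{ℓ₀}`, as a bit string. -/
def flatten (v : P.VReg lam) : Bits (P.vLen lam) :=
  fun j => (v (finProdFinEquiv.symm j).1).toBits (finProdFinEquiv.symm j).2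

end Params

/-- The primitives that the construction uses. -/
structure Primitives (P : Params) where
  /-- the primary pseudorandom function, which is copy-protected -/
  F1 : PRF P.n P.r
  /-- the secondary pseudorandom functions -/
  F2 : PRF P.ell2 P.ell1
  F3 : PRF P.ell1 P.ell2
  prg : InjectivePRG P.r
  /-- the indistinguishability obfuscator, of which only the perfect correctness is required -/
  iO : CircuitCompiler
  /-- how strings are read as circuits -/
  decodeCircuit : ∀ lam, Bits (P.q lam) → Circuit (P.vLen lam) (P.r lam + 1)

namespace Primitives

variable {P : Params} (S : Primitives P)

open Classical in
/-- The function that the circuit `P` with hardcoded `K₁, K₂, K₃` and `R⁰ᵢ, R¹ᵢ` computes. -/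
def specP (lam : ℕ) (K1 : Bits (S.F1.keyLen lam)) (K2 : Bits (S.F2.keyLen lam))
    (K3 : Bits (S.F3.keyLen lam)) (R : Bool → Fin (P.ell0 lam) → Circuit (P.κ lam) 1)
    (x : Bits (P.n lam)) (v : P.VReg lam) : Option (Bits (P.r lam)) :=
  let z : Bits (P.ell2 lam) := bxor (S.F3.eval lam K3 (Params.x1 x)) (Params.x2 x)
  let Q : Bits (P.q lam) := fun i => z (Fin.natAdd (P.ell0 lam) i)
  if (fun i => z (Fin.castAdd (P.q lam) i)) = Params.x0 x ∧ Params.x1 x = S.F2.eval lam K2 z then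
    decodeBot ((S.decodeCircuit lam Q).eval (Params.flatten v))
  else if ∀ i, (R (Params.x0 x i) i).eval (v i).toBits 0 = true then
    some (S.F1.eval lam K1 x)
  else none

/-- Circuits that compute the functions given in the construction by pseudocode, where `m` is
the output length of the circuits to be obfuscated. -/
structure Programs (m : ℕ → ℕ) where
  /-- membership in the coset `A + s` -/
  coset : ∀ lam, Submodule (ZMod 2) (Vec (P.κ lam)) → Vec (P.κ lam) → Circuit (P.κ lam) 1
  coset_eval : ∀ lam A s v, (coset lam A s).eval v.toBits 0 = true ↔ v - s ∈ A
  /-- the circuit `P` -/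
  progP : ∀ lam, Bits (S.F1.keyLen lam) → Bits (S.F2.keyLen lam) → Bits (S.F3.keyLen lam) →
    (Bool → Fin (P.ell0 lam) → Circuit (P.κ lam) 1) →
    Circuit (P.n lam + P.vLen lam) (P.r lam + 1)
  progP_eval : ∀ lam K1 K2 K3 R x v,
    (progP lam K1 K2 K3 R).eval (Fin.append x (Params.flatten v)) =
      encodeBot (S.specP lam K1 K2 K3 R x v)
  /-- the circuit `PRG · P'` -/
  progC : ∀ lam, Circuit (P.n lam + P.vLen lam) (P.r lam + 1) →
    Circuit (P.n lam + P.vLen lam) (2 * P.r lam + 1)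
  progC_eval : ∀ lam P' u,
    (progC lam P').eval u = encodeBot ((decodeBot (P'.eval u)).map (S.prg.circ lam).eval)
  /-- the circuit `D`: on input `x, v, y`, compute `y' = C(x, v)`, output `⊥` if `y' ≠ y` or
  `y' = ⊥`, and output `W(x)` otherwise -/
  progD : ∀ lam, Circuit (P.n lam + P.vLen lam) (2 * P.r lam + 1) →
    Circuit (P.n lam) (m lam) →
    Circuit (P.n lam + P.vLen lam + (2 * P.r lam + 1)) (m lam + 1)
  progD_eval : ∀ lam C W x v y,
    (progD lam C W).eval (Fin.append (Fin.append x (Params.flatten v)) y) =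
      encodeBot (if C.eval (Fin.append x (Params.flatten v)) ≠ y ∨
          decodeBot (C.eval (Fin.append x (Params.flatten v))) = none then none
        else some (W.eval x))

end Primitives

/-- Independent samples from `n` distributions. -/
def sampleAll {α : Type} : ∀ n : ℕ, (Fin n → PMF α) → PMF (Fin n → α)
  | 0, _ => PMF.pure Fin.elim0
  | n + 1, p => (p 0).bind fun a =>
      (sampleAll n fun i => p i.succ).bind fun f => PMF.pure (Fin.cons a f)

variable {P : Params} {S : Primitives P} {m : ℕ → ℕ}

/-- `CopyProtect(K₁)` of the CLLZ copy-protection scheme: the obfuscation of `P`, and the coset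
states, here through their descriptions. -/
def copyProtect (G : S.Programs m) (lam : ℕ) (K1 : Bits (S.F1.keyLen lam)) :
    PMF (Circuit (P.n lam + P.vLen lam) (P.r lam + 1) × (Fin (P.ell0 lam) → CosetKey (P.κ lam))) :=
  (S.F2.keyGen lam).bind fun K2 =>
  (S.F3.keyGen lam).bind fun K3 =>
  (PMF.uniformOfFintype (Fin (P.ell0 lam) → CosetKey (P.κ lam))).bind fun K =>
  (sampleAll (P.ell0 lam) fun i => S.iO.obf lam (G.coset lam (K i).1.1 (K i).2.1)).bind fun R0 =>
  (sampleAll (P.ell0 lam) fun i =>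
    S.iO.obf lam (G.coset lam (perp (K i).1.1) (K i).2.2)).bind fun R1 =>
  (S.iO.obf lam (G.progP lam K1 K2 K3 fun b => if b then R1 else R0)).bind fun P' =>
  PMF.pure (P', K)

/-- The classical part `(C̃, iO(D))` of the obfuscated program. -/
abbrev ClassicalPart (P : Params) (m : ℕ → ℕ) (lam : ℕ) : Type :=
  Circuit (P.n lam + P.vLen lam) (2 * P.r lam + 1) ×
    Circuit (P.n lam + P.vLen lam + (2 * P.r lam + 1)) (m lam + 1)

/-- `Obf(1^λ, W)`. -/
def upoObf (G : S.Programs m) (lam : ℕ) (W : Circuit (P.n lam) (m lam)) :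
    PMF (ClassicalPart P m lam × PureState (P.VReg lam)) :=
  (S.F1.keyGen lam).bind fun k =>
  (copyProtect G lam k).bind fun PK =>
  let C := G.progC lam PK.1
  (S.iO.obf lam C).bind fun C' =>
  (S.iO.obf lam (G.progD lam C W)).bind fun D' =>
  PMF.pure ((C', D'), cosetState PK.2)

/-- `Eval(ρ, x)`: apply the Hadamard transforms that `x₀` prescribes, run `C̃` in superposition and
measure `y`, run `iO(D)` in superposition and measure `z`, output `z`. -/
def upoEval {P : Params} {m : ℕ → ℕ} (lam : ℕ) (c : ClassicalPart P m lam) (x : Bits (P.n lam)) :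
    Instrument (P.VReg lam) (Option (Bits (m lam))) where
  Branch := Bits (2 * P.r lam + 1) × Bits (m lam + 1)
  Post := P.VReg lam
  kraus := fun yz =>
    runMeasure
        (fun v => c.2.eval (Fin.append (Fin.append x (Params.flatten v)) yz.1)) yz.2 *
      runMeasure (fun v => c.1.eval (Fin.append x (Params.flatten v))) yz.1 *
      hadamardBlocks (P.κ lam) (Params.x0 x)
  out := fun yz => decodeBot yz.2
  complete := by
    have h : ∀ (b : ℕ) (N : Matrix (P.VReg lam) (P.VReg lam) ℂ) (f : P.VReg lam → Bits b),
        ∑ z, (Nᴴ * (runMeasure f z)ᴴ) * (runMeasure f z * N) = Nᴴ * N := by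
      intro b N f
      simp_rw [Matrix.mul_assoc, ← Matrix.mul_sum, ← Matrix.mul_assoc (runMeasure f _)ᴴ,
        ← Matrix.sum_mul, runMeasure_complete, Matrix.one_mul]
    rw [Fintype.sum_prod_type]
    simp_rw [Matrix.mul_assoc (runMeasure _ _) (runMeasure _ _) (hadamardBlocks _ _)]
    simp only [Matrix.conjTranspose_mul (runMeasure _ _) (runMeasure _ _ * hadamardBlocks _ _)]
    simp_rw [h]
    simp only [Matrix.conjTranspose_mul]
    rw [h, hadamardBlocks_isometry]

/-- The unclonable puncturable obfuscation scheme. -/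
def upoScheme (G : S.Programs m) : Scheme P.n m where
  Classical := ClassicalPart P m
  Reg := P.VReg
  obf := upoObf G
  eval := upoEval

end UPO

end

namespace UPO

/-! ## Negligible functions and polynomial bounds -/

/-! Evaluation on `x` can go wrong only if the hidden trigger of the program `P` fires on `x`, and
this requires `F2(K2, z) = x1` with `z = F3(K3, x1) ⊕ x2`.

If that equation fails, the output is right with probability one (`eq_of_mem_support_of_ne`). After
the Hadamard transforms prescribed by `x0`, the state is supported on vectors `v` whose blocks lie
in the cosets `A + s` or `A^⊥ + s'` being tested, so `P'(x, v) = F1(K1, x)` and `C(x, v) ≠ ⊥` there.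
Both measurements are diagonal in the computational basis. Hence each branch of positive probability
is witnessed by one `v` for which `y = C(x, v)` and the output is `D(x, v, y) = W(x)`; no estimate
of the disturbance by the first measurement is needed.

The equation itself holds with negligible probability (`PRF.exists_negligible_guess`). Once `x` and
`K3` are fixed, `z` and `x1` are fixed strings and `K2` is still random, so the equation says that
`F2` takes a prescribed value at a prescribed point. A non-uniform distinguisher with `z` and `x1`
hardwired tests this by one query, and a random function passes with probability `2^(-ℓ₁) ≤ 2^(-λ)`.
Hardwiring the worst pair for each `λ` gives one bound for all inputs, keys and classes. -/

theorem negligible_two_inv_pow : Negligible fun lam => (2⁻¹ : ℝ) ^ lam := fun k =>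
  tendsto_pow_const_mul_const_pow_of_abs_lt_one k (by norm_num [abs_of_pos])

theorem PolyBounded.mono {f g : ℕ → ℕ} (hg : PolyBounded g) (h : ∀ lam, f lam ≤ g lam) :
    PolyBounded f := by
  obtain ⟨p, hp⟩ := hg
  exact ⟨p, fun lam => (h lam).trans (hp lam)⟩

/-! ## Reversible computations by quantum circuits -/

section Reversible

variable {a b w : ℕ}

/-- The computational basis state `|u⟩`. -/
def basisState (u : Bits w) : Bits w → ℂ := fun v => if v = u then 1 else 0

/-- Gates act on amplitudes by precomposition, which moves `|u⟩` to the preimage of `u`. The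
reversible gates used here are their own inverses, because the bit added to qubit `i` does not
depend on qubit `i`; so the preimage is also the image. -/
theorem update_apply_involutive {i : Fin w} {f : Bits w → Bool}
    (hf : ∀ u c, f (Function.update u i c) = f u) :
    Function.Involutive fun u : Bits w => Function.update u i (xor (u i) (f u)) := by
  intro u
  simp [hf]

theorem basisState_comp_involutive {g : Bits w → Bits w} (hg : Function.Involutive g)
    (u : Bits w) : (fun v => basisState u (g v)) = basisState (g u) := by
  funext v
  simp only [basisState, hg.eq_iff]

theorem apply_x_basisState (i : Fin w) (u : Bits w) :
    (QGate.x i).apply (basisState u) = basisState (Function.update u i (!(u i))) := by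
  have h := update_apply_involutive (i := i) (f := fun _ => true) fun _ _ => rfl
  simpa [QGate.apply] using basisState_comp_involutive h u

theorem apply_toffoli_basisState (c₁ c₂ i : Fin w) (h₁ : c₁ ≠ i) (h₂ : c₂ ≠ i) (u : Bits w) :
    (QGate.toffoli c₁ c₂ i h₁ h₂).apply (basisState u) =
      basisState (Function.update u i (xor (u i) (u c₁ && u c₂))) := by
  have h := update_apply_involutive (i := i) (f := fun u => u c₁ && u c₂) fun u c => by
    simp [h₁, h₂]
  exact basisState_comp_involutive h u

/-- Disposes of the query outcomes that have amplitude zero. -/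
theorem acceptProb_zero (f : Bits a → Bits b) (o : Fin w) (l : List (QInstr a b w)) :
    acceptProb f o l (fun _ => 0) = 0 := by
  induction l with
  | nil => simp [acceptProb]
  | cons s l ih =>
    cases s with
    | gate g =>
      have : g.apply (fun _ => 0) = fun _ => 0 := by cases g <;> simp [QGate.apply]
      rw [acceptProb, this, ih]
    | query inp out =>
      have : ∀ q, queryBranch f inp out q (fun _ => 0) = fun _ => 0 := fun q => by
        simp [queryBranch]
      simp only [acceptProb, this, ih, Finset.sum_const_zero]

theorem acceptProb_nil_basisState (f : Bits a → Bits b) (o : Fin w) (u : Bits w) :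
    acceptProb f o [] (basisState u) = if u o = true then 1 else 0 := by
  rw [acceptProb, Finset.sum_eq_single u]
  · simp [basisState]
  · intro v _ hv
    simp [basisState, hv]
  · simp

/-- Measuring the query register of a basis state has only one possible outcome, so a single branch
of the sum survives and the query acts as a classical reversible step. -/
theorem acceptProb_query_basisState (f : Bits a → Bits b) (o : Fin w) (inp : Fin a → Fin w)
    (out : Fin b ↪ Fin w) (l : List (QInstr a b w)) (u : Bits w) :
    acceptProb f o (.query inp out :: l) (basisState u) =
      acceptProb f o l (basisState fun i =>
        xor (u i) (decide (∃ j, out j = i ∧ f (fun j => u (inp j)) j = true))) := by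
  rw [acceptProb, Finset.sum_eq_single fun j => u (inp j)]
  · congr 1
    have h : ∀ v : Bits w, (if (fun j => v (inp j)) = (fun j => u (inp j)) then
        basisState u v else 0) = basisState u v := by
      intro v
      by_cases hv : v = u <;> simp [hv, basisState]
    have hinv : Function.Involutive fun (v : Bits w) i => xor (v i)
        (decide (∃ j, out j = i ∧ f (fun j => u (inp j)) j = true)) := fun v => by simp
    exact (funext fun v => h _).trans (basisState_comp_involutive hinv u)
  · intro q _ hq
    have h : ∀ v : Bits w, (if (fun j => v (inp j)) = q then basisState u v else 0) = 0 := by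
      intro v
      by_cases hv : v = u
      · simp [hv, hq.symm]
      · simp [hv, basisState]
    have h' : queryBranch f inp out q (basisState u) = fun _ => 0 :=
      funext fun v => h fun i => xor (v i) (decide (∃ j, out j = i ∧ f q j = true))
    rw [h', acceptProb_zero]
  · simp

/-- Flipping the qubits in a list without repetitions. -/
theorem acceptProb_map_x (f : Bits a → Bits b) (o : Fin w) (l : List (QInstr a b w))
    (L : List (Fin w)) (hL : L.Nodup) (u : Bits w) :
    acceptProb f o (L.map (fun i => .gate (.x i)) ++ l) (basisState u) =
      acceptProb f o l (basisState fun i => xor (u i) (decide (i ∈ L))) := by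
  induction L generalizing u with
  | nil => simp
  | cons i L ih =>
    rw [List.nodup_cons] at hL
    rw [List.map_cons, List.cons_append, acceptProb, apply_x_basisState, ih hL.2]
    congr 2
    funext j
    by_cases hj : j = i
    · subst hj
      simp [hL.1]
    · simp [hj]

/-- The Toffoli gates that write the conjunction of the qubits `O 0, …, O (k - 1)` to `T k`, where
`T 0` is set and the other qubits of `T` are not. -/
def andChain (O : Fin b → Fin w) (T : Fin (b + 1) → Fin w) (hOT : ∀ i j, O i ≠ T j)
    (hT : Function.Injective T) : ∀ k, k ≤ b → List (QInstr a b w)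
  | 0, _ => []
  | k + 1, hk => andChain O T hOT hT k (Nat.le_of_succ_le hk) ++
      [.gate (.toffoli (O ⟨k, hk⟩) (T (Fin.castSucc ⟨k, hk⟩)) (T (Fin.succ ⟨k, hk⟩)) (hOT _ _)
        (hT.ne (Fin.castSucc_lt_succ).ne))]

theorem length_andChain (O : Fin b → Fin w) (T : Fin (b + 1) → Fin w) (hOT : ∀ i j, O i ≠ T j)
    (hT : Function.Injective T) (k : ℕ) (hk : k ≤ b) :
    (andChain (a := a) O T hOT hT k hk).length = k := by
  induction k with
  | zero => rfl
  | succ k ih => simp [andChain, ih]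

/-- Induction along the chain. The last clause, that later ancillas are still clear, is part of the
invariant because a Toffoli gate adds the conjunction to its target instead of overwriting it. -/
theorem acceptProb_andChain (f : Bits a → Bits b) (o : Fin w) (O : Fin b → Fin w)
    (T : Fin (b + 1) → Fin w) (hOT : ∀ i j, O i ≠ T j) (hT : Function.Injective T) (u : Bits w)
    (hu0 : u (T 0) = true) (hu : ∀ j : Fin b, u (T j.succ) = false) (k : ℕ) (hk : k ≤ b) :
    ∃ u' : Bits w, (∀ l, acceptProb f o (andChain O T hOT hT k hk ++ l) (basisState u) =
        acceptProb f o l (basisState u')) ∧ (∀ i, u' (O i) = u (O i)) ∧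
      (u' (T ⟨k, Nat.lt_succ_of_le hk⟩) = true ↔ ∀ i : Fin b, i.1 < k → u (O i) = true) ∧
      ∀ j : Fin b, k ≤ j → u' (T j.succ) = false := by
  induction k with
  | zero => exact ⟨u, fun l => rfl, fun i => rfl, by simpa using hu0, fun j _ => hu j⟩
  | succ k ih =>
    obtain ⟨u', h1, h2, h3, h4⟩ := ih (Nat.le_of_succ_le hk)
    refine ⟨Function.update u' (T (Fin.succ ⟨k, hk⟩)) (xor (u' (T (Fin.succ ⟨k, hk⟩)))
      (u' (O ⟨k, hk⟩) && u' (T (Fin.castSucc ⟨k, hk⟩)))),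
      fun l => ?_, fun i => ?_, ?_, fun j hj => ?_⟩
    · rw [andChain, List.append_assoc, h1, List.singleton_append, acceptProb,
        apply_toffoli_basisState]
    · rw [Function.update_of_ne (hOT _ _), h2]
    · have e : (⟨k + 1, Nat.lt_succ_of_le hk⟩ : Fin (b + 1)) = Fin.succ ⟨k, hk⟩ := rfl
      have e' : (Fin.castSucc ⟨k, hk⟩ : Fin (b + 1)) =
        ⟨k, Nat.lt_succ_of_le (Nat.le_of_succ_le hk)⟩ := rfl
      rw [e, Function.update_self, h4 _ le_rfl, Bool.false_xor, Bool.and_eq_true, e', h3, h2]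
      constructor
      · rintro ⟨h5, h6⟩ i hi
        rcases Nat.lt_succ_iff_lt_or_eq.mp hi with hi | hi
        · exact h6 i hi
        · rwa [show i = ⟨k, hk⟩ from Fin.ext hi]
      · exact fun h => ⟨h _ (Nat.lt_succ_self k), fun i hi => h i (Nat.lt_succ_of_lt hi)⟩
    · rw [Function.update_of_ne, h4 j (Nat.le_of_succ_le hj)]
      exact hT.ne fun h => by
        have := congrArg Fin.val h
        simp at this
        omega

end Reversible

/-! ## Guessing one value of a pseudorandom function -/

section Guess

variable {a b : ℕ}

/-- The circuit that queries `z` and accepts if the answer is `y`. -/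
def guessCircuit (z : Bits a) (y : Bits b) : OracleCircuit a b where
  -- The registers are `a` query qubits, `b` answer qubits and `b + 1` ancillas, prepared by bit
  -- flips as `z`, `¬y` and `10…0`. The query turns the answer register into `¬y ⊕ f(z)`, which is
  -- all ones exactly when `f(z) = y`; the chain writes this conjunction to the last ancilla.
  width := a + b + (b + 1)
  output := Fin.natAdd (a + b) (Fin.last b)
  instrs :=
    ((List.finRange (a + b + (b + 1))).filter fun i => (Fin.append
      (Fin.append z (fun j => !(y j))) (Fin.cons true fun _ => false : Bits (b + 1)) :
        Bits (a + b + (b + 1))) i).map (fun i => .gate (.x i)) ++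
    (.query (fun j => Fin.castAdd (b + 1) (Fin.castAdd b j))
      ⟨fun j => Fin.castAdd (b + 1) (Fin.natAdd a j), fun i j h => by
        simpa [Fin.ext_iff] using h⟩ ::
      (andChain (fun j => Fin.castAdd (b + 1) (Fin.natAdd a j)) (Fin.natAdd (a + b))
        (fun i j h => by simp [Fin.ext_iff] at h; omega) (Fin.natAdd_injective _ _) b le_rfl ++ []))

/-- The width and the bit flips contribute at most `a + 2b + 1` each, the query `1` and the chain
`b`. -/
theorem size_guessCircuit_le (z : Bits a) (y : Bits b) :
    (guessCircuit z y).size ≤ 5 * (a + b) + 3 := by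
  have h := List.length_filter_le (fun i => (Fin.append
      (Fin.append z (fun j => !(y j))) (Fin.cons true fun _ => false : Bits (b + 1)) :
        Bits (a + b + (b + 1))) i) (List.finRange (a + b + (b + 1)))
  simp only [List.length_finRange] at h
  simp only [OracleCircuit.size, guessCircuit, List.length_append, List.length_map,
    List.length_cons, length_andChain, List.length_nil]
  omega

theorem prob_guessCircuit (z : Bits a) (y : Bits b) (f : Bits a → Bits b) :
    (guessCircuit z y).prob f = if f z = y then 1 else 0 := by
  simp only [OracleCircuit.prob, guessCircuit]
  change acceptProb f _ _ (basisState fun _ => false) = _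
  rw [acceptProb_map_x _ _ _ _ ((List.nodup_finRange _).filter _), acceptProb_query_basisState]
  simp only [List.mem_filter, List.mem_finRange, true_and, Bool.decide_eq_true, Bool.false_xor,
    Fin.append_left]
  set O : Fin b → Fin (a + b + (b + 1)) := fun j => Fin.castAdd (b + 1) (Fin.natAdd a j) with hO
  have hOT : ∀ i j, O i ≠ Fin.natAdd (a + b) j := fun i j h => by
    simp [hO, Fin.ext_iff] at h
    omega
  have hOinj : ∀ i j, O i = O j ↔ i = j := fun i j => by simp [hO, Fin.ext_iff]
  obtain ⟨u', h1, -, h3, -⟩ := acceptProb_andChain f (Fin.natAdd (a + b) (Fin.last b)) O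
    (Fin.natAdd (a + b)) hOT (Fin.natAdd_injective _ _) (fun i => xor ((Fin.append
      (Fin.append z (fun j => !(y j))) (Fin.cons true fun _ => false : Bits (b + 1)) :
        Bits (a + b + (b + 1))) i) (decide (∃ j, O j = i ∧ f z j = true)))
    (by simp [hOT]) (by simp [hOT]) b le_rfl
  refine (h1 []).trans ?_
  rw [acceptProb_nil_basisState]
  refine if_congr (Iff.trans h3 ?_) rfl rfl
  rw [funext_iff]
  refine forall_congr' fun i => ?_
  simp only [i.2, forall_const, hOinj, exists_eq_left]
  simp only [hO, Fin.append_left, Fin.append_right]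
  cases f z i <;> cases y i <;> simp

end Guess

/-- A function is its value at `z` together with its restriction to the other points, so the value
of a uniform function at `z` is uniform. -/
theorem sum_ite_apply_eq_div {α β : Type} [Fintype α] [DecidableEq α] [Fintype β]
    [DecidableEq β] [Nonempty β] (z : α) (y : β) :
    (∑ f : α → β, if f z = y then (1 : ℝ) else 0) / Fintype.card (α → β) =
      (Fintype.card β : ℝ)⁻¹ := by
  have hβ : (Fintype.card β : ℝ) ≠ 0 := by exact_mod_cast Fintype.card_ne_zero
  have hγ : (Fintype.card ({j // j ≠ z} → β) : ℝ) ≠ 0 := by exact_mod_cast Fintype.card_ne_zero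
  rw [Fintype.card_congr (Equiv.funSplitAt z β), Fintype.card_prod,
    Fintype.sum_equiv (Equiv.funSplitAt z β) (fun f => if f z = y then (1 : ℝ) else 0)
      (fun p => if p.1 = y then (1 : ℝ) else 0) (fun f => rfl), Fintype.sum_prod_type]
  have h : ∑ b : β, ∑ _g : {j // j ≠ z} → β, (if b = y then (1 : ℝ) else 0) =
      Fintype.card ({j // j ≠ z} → β) := by
    rw [Finset.sum_eq_single y (fun b _ hb => by simp [hb]) (by simp)]
    simp only [if_true, Finset.sum_const, Finset.card_univ, nsmul_eq_mul, mul_one]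
  rw [h, Nat.cast_mul]
  field_simp

/-- Translates between the law of a value under `keyGen` and the real average over coins that
appears in `PRF.secure`. -/
theorem PRF.map_keyGen_apply {a b : ℕ → ℕ} (F : PRF a b) (lam : ℕ) (z : Bits (a lam))
    (y : Bits (b lam)) :
    ((F.keyGen lam).map fun k => F.eval lam k z) y = ENNReal.ofReal
      ((∑ c : Bits (F.coinLen lam), if (F.evalCirc lam).eval
          (Fin.append ((F.keyGenCirc lam).eval c) z) = y then (1 : ℝ) else 0) /
        Fintype.card (Bits (F.coinLen lam))) := by
  have hc : (0 : ℝ) < Fintype.card (Bits (F.coinLen lam)) := by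
    exact_mod_cast Fintype.card_pos
  rw [PRF.keyGen, PMF.map_comp, PMF.map_apply, tsum_fintype, Finset.sum_div,
    ENNReal.ofReal_sum_of_nonneg (fun c _ => by positivity)]
  refine Finset.sum_congr rfl fun c _ => ?_
  simp only [Function.comp, PRF.eval, eq_comm (a := y), PMF.uniformOfFintype_apply]
  split_ifs
  · rw [one_div, ENNReal.ofReal_inv_of_pos hc, ENNReal.ofReal_natCast]
  · simp

/-- The values of a pseudorandom function with long outputs cannot be predicted without the key. -/
theorem PRF.exists_negligible_guess {a b : ℕ → ℕ} (F : PRF a b) (hb : ∀ lam, lam ≤ b lam) :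
    ∃ negl : ℕ → ℝ, Negligible negl ∧ (∀ lam, 0 ≤ negl lam) ∧ ∀ lam z y,
      ((F.keyGen lam).map fun k => F.eval lam k z) y ≤ ENNReal.ofReal (negl lam) := by
  let p : ∀ lam, Bits (a lam) × Bits (b lam) → ℝ := fun lam zy =>
    (∑ c : Bits (F.coinLen lam), if (F.evalCirc lam).eval
      (Fin.append ((F.keyGenCirc lam).eval c) zy.1) = zy.2 then (1 : ℝ) else 0) /
        Fintype.card (Bits (F.coinLen lam))
  -- Distinguishers are non-uniform, so the most likely pair for each `λ` may be hardwired; this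
  -- makes the bound uniform in `z` and `y`.
  choose best hbest using fun lam => Finite.exists_max (p lam)
  -- The size of the evaluation circuit counts its input and output bits, hence bounds `a` and `b`
  -- polynomially.
  have hpoly : PolyBounded fun lam => 5 * (a lam + b lam) + 3 := by
    obtain ⟨q, hq⟩ := F.eval_poly
    refine ⟨5 * q + 3, fun lam => ?_⟩
    have := hq lam
    simp only [Circuit.size] at this
    simp only [Polynomial.eval_add, Polynomial.eval_mul, Polynomial.eval_ofNat]
    omega
  let A : QPTDistinguisher a b :=
    { circ := fun lam => guessCircuit (best lam).1 (best lam).2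
      poly_size := hpoly.mono fun lam => size_guessCircuit_le _ _ }
  have hA := F.secure A
  simp only [A, prob_guessCircuit, sum_ite_apply_eq_div] at hA
  -- The bound is the advantage of `A` plus `2^(-λ)`, the latter dominating the success probability
  -- against a random function.
  refine ⟨_, hA.add negligible_two_inv_pow, fun lam => ?_, fun lam z y => ?_⟩
  · simp only [Pi.add_apply]
    positivity
  · rw [F.map_keyGen_apply]
    refine ENNReal.ofReal_le_ofReal ((hbest lam (z, y)).trans ?_)
    have h1 : (Fintype.card (Bits (b lam)) : ℝ)⁻¹ ≤ 2⁻¹ ^ lam := by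
      rw [Fintype.card_fun, Fintype.card_bool, Fintype.card_fin, Nat.cast_pow, Nat.cast_ofNat,
        ← inv_pow]
      exact pow_le_pow_of_le_one (by norm_num) (by norm_num) (hb lam)
    have h2 := le_abs_self (p lam (best lam) - (Fintype.card (Bits (b lam)) : ℝ)⁻¹)
    simp only [Pi.add_apply]
    change p lam (best lam) ≤ |p lam (best lam) - _| + _
    linarith

/-! ## The support of Hadamard transforms of coset states -/

/-- The nontrivial character of `𝔽₂`. -/
def signChar (t : ZMod 2) : ℂ := if t = 0 then 1 else -1

theorem signChar_add (s t : ZMod 2) : signChar (s + t) = signChar s * signChar t := by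
  have h : ∀ s t : ZMod 2, s + t = 0 ↔ (s = 0 ↔ t = 0) := by decide
  simp only [signChar, h]
  by_cases hs : s = 0 <;> by_cases ht : t = 0 <;> simp [hs, ht]

theorem signChar_sum {ι : Type} (s : Finset ι) (f : ι → ZMod 2) :
    signChar (∑ i ∈ s, f i) = ∏ i ∈ s, signChar (f i) := by
  classical
  induction s using Finset.induction_on with
  | empty => simp [signChar]
  | insert i s hi ih => rw [Finset.sum_insert hi, Finset.prod_insert hi, signChar_add, ih]

theorem hadamard_add (u v a : ZMod 2) :
    hadamard u (v + a) = hadamard u v * signChar (u * a) := by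
  have h := signChar_add (u * v) (u * a)
  simp only [hadamard, Matrix.of_apply, mul_add]
  change _ * signChar _ = _ * signChar _ * _
  rw [h, mul_assoc]

/-- Translation by `a ∈ A` preserves the coset `A + s` and changes the phase by the character
attached to `s'`. -/
theorem cosetAmp_add {κ : ℕ} (K : CosetKey κ) (v : Vec κ) {a : Vec κ} (ha : a ∈ K.1.1) :
    cosetAmp K (v + a) = cosetAmp K v * signChar (K.2.2 ⬝ᵥ a) := by
  have h1 : v + a - K.2.1 = (v - K.2.1) + a := by abel
  have h2 := signChar_add (K.2.2 ⬝ᵥ (v - K.2.1)) (K.2.2 ⬝ᵥ a)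
  have h3 : v + a - K.2.1 ∈ K.1.1 ↔ v - K.2.1 ∈ K.1.1 := h1 ▸ K.1.1.add_mem_iff_left ha
  rw [cosetAmp, cosetAmp]
  by_cases h : v - K.2.1 ∈ K.1.1
  · rw [if_pos h, if_pos (h3.mpr h), h1, dotProduct_add]
    change _ * signChar _ = _ * signChar _ * _
    rw [h2, mul_assoc]
  · rw [if_neg h, if_neg (mt h3.mp h), zero_mul]

theorem mem_of_cosetAmp_ne_zero {κ : ℕ} {K : CosetKey κ} {v : Vec κ} (h : cosetAmp K v ≠ 0) :
    v - K.2.1 ∈ K.1.1 := by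
  by_contra hv
  exact h (if_neg hv)

/-- `H^{⊗κ} |A_{s,s'}⟩` is supported on `A^⊥ + s'`. -/
theorem mem_perp_of_hadamard_ne_zero {κ : ℕ} {K : CosetKey κ} {u : Vec κ}
    (h : (tensorMat (fun _ : Fin κ => hadamard) *ᵥ cosetAmp K) u ≠ 0) :
    u - K.2.2 ∈ perp K.1.1 := by
  by_contra hu
  have hu' : ∃ a ∈ K.1.1, a ⬝ᵥ (u - K.2.2) ≠ 0 := by
    by_contra! h'
    exact hu h'
  obtain ⟨a, ha, hau⟩ := hu'
  refine h ?_
  -- Since `⟨a, u - s'⟩ ≠ 0`, translating by `a` flips the sign of every term of the sum defining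
  -- the amplitude at `u`. It also permutes the terms, so the amplitude equals its own negative.
  have hshift : ∀ v, tensorMat (fun _ : Fin κ => hadamard) u (v + a) * cosetAmp K (v + a) =
      -(tensorMat (fun _ : Fin κ => hadamard) u v * cosetAmp K v) := by
    intro v
    have hsign : signChar (u ⬝ᵥ a) * signChar (K.2.2 ⬝ᵥ a) = -1 := by
      rw [← signChar_add, ← add_dotProduct, signChar, if_neg]
      rwa [dotProduct_comm, show u + K.2.2 = u - K.2.2 from
        funext fun i => (CharTwo.sub_eq_add (u i) (K.2.2 i)).symm]
    have h1 : tensorMat (fun _ : Fin κ => hadamard) u (v + a) =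
        tensorMat (fun _ : Fin κ => hadamard) u v * signChar (u ⬝ᵥ a) := by
      simp only [tensorMat, Matrix.of_apply, Pi.add_apply, hadamard_add, dotProduct,
        signChar_sum, Finset.prod_mul_distrib]
    rw [h1, cosetAmp_add K v ha, mul_mul_mul_comm, hsign, mul_neg_one]
  have hsum := Equiv.sum_comp (Equiv.addRight a)
    fun v => tensorMat (fun _ : Fin κ => hadamard) u v * cosetAmp K v
  simp only [Equiv.coe_addRight, hshift, Finset.sum_neg_distrib] at hsum
  exact CharZero.neg_eq_self_iff.mp hsum

theorem tensorMat_mulVec_prod {ι α : Type} [Fintype ι] [DecidableEq ι] [Fintype α]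
    (M : ι → Matrix α α ℂ) (ψ : ι → α → ℂ) (u : ι → α) :
    (tensorMat M *ᵥ fun v => ∏ i, ψ i (v i)) u = ∏ i, (M i *ᵥ ψ i) (u i) := by
  simp only [Matrix.mulVec, dotProduct, tensorMat, Matrix.of_apply, ← Finset.prod_mul_distrib]
  exact (Fintype.prod_sum fun i a => M i (u i) a * ψ i a).symm

theorem mem_of_hadamardBlocks_cosetState_ne_zero {ell κ : ℕ} {K : Fin ell → CosetKey κ}
    {r : Bits ell} {v : Fin ell → Vec κ}
    (h : (hadamardBlocks κ r *ᵥ (cosetState K).1) v ≠ 0) (i : Fin ell) :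
    if r i = true then v i - (K i).2.2 ∈ perp (K i).1.1 else v i - (K i).2.1 ∈ (K i).1.1 := by
  rw [hadamardBlocks, cosetState, tensorMat_mulVec_prod, Finset.prod_ne_zero_iff] at h
  have hi := h i (Finset.mem_univ i)
  split_ifs at hi ⊢
  · exact mem_perp_of_hadamard_ne_zero hi
  · rw [Matrix.one_mulVec] at hi
    exact mem_of_cosetAmp_ne_zero hi

/-! ## Correctness of the construction -/

theorem decodeBot_encodeBot {m : ℕ} (y : Option (Bits m)) : decodeBot (encodeBot y) = y := by
  cases y <;> simp [decodeBot, encodeBot]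

theorem mem_support_of_mem_support_sampleAll {α : Type} {n : ℕ} {p : Fin n → PMF α}
    {f : Fin n → α} (hf : f ∈ (sampleAll n p).support) (i : Fin n) : f i ∈ (p i).support := by
  induction n with
  | zero => exact i.elim0
  | succ n ih =>
    simp only [sampleAll, PMF.mem_support_bind_iff, PMF.mem_support_pure_iff] at hf
    obtain ⟨a, ha, g, hg, rfl⟩ := hf
    refine Fin.cases ?_ (fun j => ?_) i
    · simpa using ha
    · simpa using ih hg j

variable {P : Params} {S : Primitives P} {m : ℕ → ℕ}

theorem Instrument.exists_of_mem_support_outputLaw {ι O : Type} [Fintype ι] [DecidableEq ι]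
    {E : Instrument ι O} {ψ : PureState ι} {o : O} (h : o ∈ (E.outputLaw ψ).support) :
    ∃ j p, E.out j = o ∧ (E.kraus j *ᵥ ψ.1) p ≠ 0 := by
  rw [outputLaw, PMF.mem_support_map_iff] at h
  obtain ⟨j, hj, rfl⟩ := h
  by_contra! h0
  refine (PMF.mem_support_iff _ _).mp hj ?_
  simp only [branchLaw, PMF.ofFintype_apply]
  simp [h0 j _ rfl]

theorem runMeasure_mulVec {V : Type} [Fintype V] [DecidableEq V] {b : ℕ} (f : V → Bits b)
    (y : Bits b) (φ : V → ℂ) (v : V) :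
    (runMeasure f y *ᵥ φ) v = (if f v = y then 1 else 0) * φ v := by
  rw [runMeasure_eq, Matrix.mulVec_diagonal]

/-- An output of `Eval` is the value of the second circuit on a basis state that has nonzero
amplitude after the Hadamard transforms. -/
theorem exists_of_mem_support_upoEval {lam : ℕ} {c : ClassicalPart P m lam} {x : Bits (P.n lam)}
    {ψ : PureState (P.VReg lam)} {o : Option (Bits (m lam))}
    (h : o ∈ ((upoEval lam c x).outputLaw ψ).support) :
    ∃ v, (hadamardBlocks (P.κ lam) (Params.x0 x) *ᵥ ψ.1) v ≠ 0 ∧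
      o = decodeBot (c.2.eval (Fin.append (Fin.append x (Params.flatten v))
        (c.1.eval (Fin.append x (Params.flatten v))))) := by
  obtain ⟨⟨y, z⟩, v, ho, hv⟩ := Instrument.exists_of_mem_support_outputLaw h
  change P.VReg lam at v
  change decodeBot z = o at ho
  change ((runMeasure (fun v => c.2.eval (Fin.append (Fin.append x (Params.flatten v)) y)) z *
    runMeasure (fun v => c.1.eval (Fin.append x (Params.flatten v))) y *
      hadamardBlocks (P.κ lam) (Params.x0 x)) *ᵥ ψ.1) v ≠ 0 at hv
  -- Both measurement operators are diagonal with entries 0 and 1. A nonzero amplitude at `v`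
  -- therefore passes both at the same `v`, which determines `y` and `z`.
  rw [← Matrix.mulVec_mulVec, ← Matrix.mulVec_mulVec, runMeasure_mulVec, runMeasure_mulVec] at hv
  have hz := left_ne_zero_of_mul hv
  have hy := left_ne_zero_of_mul (right_ne_zero_of_mul hv)
  simp only [ne_eq, ite_eq_right_iff, one_ne_zero, imp_false, not_not] at hz hy
  exact ⟨v, right_ne_zero_of_mul (right_ne_zero_of_mul hv), by rw [← ho, hy, hz]⟩

/-- Refuting the `F2` half of the trigger condition is enough, whatever the leading bits of `z` and
the string `Q` are. -/
theorem Primitives.specP_of_ne {lam : ℕ} {K1 : Bits (S.F1.keyLen lam)}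
    {K2 : Bits (S.F2.keyLen lam)} {K3 : Bits (S.F3.keyLen lam)}
    {R : Bool → Fin (P.ell0 lam) → Circuit (P.κ lam) 1} {x : Bits (P.n lam)} {v : P.VReg lam}
    (hx : S.F2.eval lam K2 (bxor (S.F3.eval lam K3 (Params.x1 x)) (Params.x2 x)) ≠ Params.x1 x)
    (hR : ∀ i, (R (Params.x0 x i) i).eval (v i).toBits 0 = true) :
    S.specP lam K1 K2 K3 R x v = some (S.F1.eval lam K1 x) := by
  rw [specP]
  rw [if_neg fun h => hx h.2.symm, if_pos hR]

/-- If the hidden trigger does not fire on `x`, evaluation always succeeds. -/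
theorem eq_of_mem_support_of_ne {G : S.Programs m} {lam : ℕ} {W : Circuit (P.n lam) (m lam)}
    {x : Bits (P.n lam)} {K1 : Bits (S.F1.keyLen lam)}
    {K2 : Bits (S.F2.keyLen lam)} {K3 : Bits (S.F3.keyLen lam)}
    (hx : S.F2.eval lam K2 (bxor (S.F3.eval lam K3 (Params.x1 x)) (Params.x2 x)) ≠ Params.x1 x)
    {K : Fin (P.ell0 lam) → CosetKey (P.κ lam)} {R0 R1 : Fin (P.ell0 lam) → Circuit (P.κ lam) 1}
    (hR0 : ∀ i, R0 i ∈ (S.iO.obf lam (G.coset lam (K i).1.1 (K i).2.1)).support)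
    (hR1 : ∀ i, R1 i ∈ (S.iO.obf lam (G.coset lam (perp (K i).1.1) (K i).2.2)).support)
    {P' : Circuit (P.n lam + P.vLen lam) (P.r lam + 1)}
    (hP' : P' ∈ (S.iO.obf lam (G.progP lam K1 K2 K3 fun b => if b then R1 else R0)).support)
    {c : ClassicalPart P m lam} (hc1 : c.1 ∈ (S.iO.obf lam (G.progC lam P')).support)
    (hc2 : c.2 ∈ (S.iO.obf lam (G.progD lam (G.progC lam P') W)).support)
    {o : Option (Bits (m lam))}
    (ho : o ∈ ((upoEval lam c x).outputLaw (cosetState K)).support) : o = some (W.eval x) := by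
  obtain ⟨v, hv, rfl⟩ := exists_of_mem_support_upoEval ho
  have hR : ∀ i, (((fun b => if b then R1 else R0 :
      Bool → Fin (P.ell0 lam) → Circuit (P.κ lam) 1)) (Params.x0 x i) i).eval
        (v i).toBits 0 = true := by
    intro i
    have hi := mem_of_hadamardBlocks_cosetState_ne_zero hv i
    cases h : Params.x0 x i
    · simp only [h, Bool.false_eq_true, if_false] at hi ⊢
      rw [S.iO.correct _ _ _ (hR0 i), G.coset_eval]
      exact hi
    · simp only [h, if_true] at hi ⊢
      rw [S.iO.correct _ _ _ (hR1 i), G.coset_eval]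
      exact hi
  -- `D` recomputes `C(x, v)`, and `C̃` computes the same function at the same `v`, so the
  -- comparison with `y` succeeds automatically. What remains is to exclude `C(x, v) = ⊥`.
  rw [S.iO.correct _ _ _ hc2, S.iO.correct _ _ _ hc1, G.progD_eval, decodeBot_encodeBot, if_neg]
  rw [G.progC_eval, S.iO.correct _ _ _ hP', G.progP_eval, Primitives.specP_of_ne hx hR]
  simp [decodeBot_encodeBot]

/-! ### Averaging over the randomness of the obfuscator -/

theorem PMF_one_sub_map_le_bind {α β γ : Type} (p : PMF α) (f : α → PMF β) (g : α → γ) (y : γ)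
    (b : β) (h : ∀ a, g a ≠ y → f a b = 1) : 1 - (p.map g) y ≤ (p.bind f) b := by
  classical
  rw [tsub_le_iff_right, PMF.bind_apply, PMF.map_apply, ← ENNReal.tsum_add, ← p.tsum_coe]
  -- Termwise comparison: the mass of each `a` is counted in full either by the event `g a = y` or
  -- by the success probability, which is `1` off that event.
  refine ENNReal.tsum_le_tsum fun a => ?_
  by_cases hy : y = g a
  · simp [hy]
  · rw [h a fun h' => hy h'.symm, mul_one]
    exact le_self_add

theorem PMF_le_bind {α β : Type} (p : PMF α) (f : α → PMF β) (b : β) (c : ENNReal)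
    (h : ∀ a, c ≤ f a b) : c ≤ (p.bind f) b := by
  rw [PMF.bind_apply]
  calc c = ∑' a, p a * c := by rw [ENNReal.tsum_mul_right, p.tsum_coe, one_mul]
    _ ≤ _ := ENNReal.tsum_le_tsum fun a => mul_le_mul_right (h a) _

theorem one_sub_le_outputLaw_upoScheme (G : S.Programs m) (lam : ℕ)
    (W : Circuit (P.n lam) (m lam)) (x : Bits (P.n lam)) (ε : ENNReal)
    (hε : ∀ z y, ((S.F2.keyGen lam).map fun k => S.F2.eval lam k z) y ≤ ε) :
    1 - ε ≤ (upoScheme G).outputLaw lam W x (some (W.eval x)) := by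
  change 1 - ε ≤ ((upoObf G lam W).bind fun ρ => (upoEval lam ρ.1 x).outputLaw ρ.2) _
  simp only [upoObf, copyProtect, PMF.bind_bind, PMF.pure_bind]
  refine PMF_le_bind _ _ _ _ fun K1 => ?_
  -- `K3` is drawn before `K2`, so that the point at which `F2` is evaluated is fixed when `K2` is
  -- drawn.
  rw [PMF.bind_comm]
  refine PMF_le_bind _ _ _ _ fun K3 => ?_
  refine (tsub_le_tsub_left (hε (bxor (S.F3.eval lam K3 (Params.x1 x)) (Params.x2 x))
    (Params.x1 x)) 1).trans (PMF_one_sub_map_le_bind _ _ _ _ _ fun K2 hx => ?_)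
  rw [PMF.apply_eq_one_iff]
  -- Success with probability one is a statement about supports: every possible output has to be the
  -- right one. This reduces the remaining random choices to arbitrary elements of their supports.
  refine Set.Nonempty.subset_singleton_iff (PMF.support_nonempty _) |>.mp fun o ho => ?_
  simp only [PMF.mem_support_bind_iff] at ho
  obtain ⟨K, -, R0, hR0, R1, hR1, P', hP', C', hC', D', hD', ho⟩ := ho
  exact eq_of_mem_support_of_ne hx (mem_support_of_mem_support_sampleAll hR0)
    (mem_support_of_mem_support_sampleAll hR1) hP' hC' hD' ho

end UPO

theorem mainTheorem12 (P : UPO.Params) (hP : ∀ lam, lam ≤ P.ell1 lam) (S : UPO.Primitives P)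
    (m : ℕ → ℕ) (G : S.Programs m) :
    ∃ negl : ℕ → ℝ, UPO.Negligible negl ∧
      ∀ 𝒞 : UPO.GenPuncturableClass P.n m,
        (UPO.upoScheme G).IsCorrect 𝒞 (fun lam => 1 - negl lam) := by
  -- The negligible function depends on `F2` only and is fixed before the class, as the order of
  -- quantifiers demands.
  obtain ⟨negl, hnegl, hpos, hguess⟩ := S.F2.exists_negligible_guess hP
  refine ⟨negl, hnegl, fun 𝒞 lam k x => ?_⟩
  have h := UPO.one_sub_le_outputLaw_upoScheme G lam (𝒞.circ lam k) x _ (hguess lam)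
  -- Subtraction in `ENNReal` is truncated, so the inequality is put in additive form before it is
  -- carried to the reals.
  rw [tsub_le_iff_right] at h
  have h' := ENNReal.toReal_mono 
    (ENNReal.add_ne_top.mpr ⟨PMF.apply_ne_top _ _, ENNReal.ofReal_ne_top⟩) h
  rw [ENNReal.toReal_add (PMF.apply_ne_top _ _) ENNReal.ofReal_ne_top, ENNReal.toReal_one,
    ENNReal.toReal_ofReal (hpos lam)] at h'
  exact sub_le_iff_le_add.mpr h'
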